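/- Conventions. For a finite family $(x_i)_{i\in I}$ of real numbers and $\alpha\in\mathbb R$ let $\xi(\alpha)=\operatorname{Card}\{i: x_i=\alpha\}-\operatorname{Card}\{i: x_i=-\alpha\}$ and $J=\{i\in I:\xi(x_i)\neq 0\}$. Define $\boxplus_{i\in I}x_i=0$ if $J=\emptyset$; otherwise, with $m=\max_{i\in J}|x_i|$, define $\boxplus_{i\in I}x_i=\max_{i\in J}x_i$ if $\xi(m)>0$, $\min_{i\in J}x_i$ if $\xi(m)<0$, and $0$ if $\xi(m)=0$. For a real $n\times n$ matrix $A$ and $v\in\mathbb R^n$ put $(A\boxtimes v)_i=\boxplus_{j=1}^n a_{i,j}v_j$. A real number $\lambda>0$ is a $\boxtimes$-eigenvalue of $A$ if $A\boxtimes v=\lambda v$ for some $v\in\mathbb R_+^n\setminus\{0\}$. For $u,v\in\mathbb R$ let $u\smile^- v$ (resp. $u\smile^+v$) be the one of $u,v$ with the larger absolute value, and $\min\{u,v\}$ (resp. $\max\{u,v\}$) if $|u|=|v|$; both operations are associative and commutative. Let $P_{A,-}^{\infty}(\lambda)$ (resp. $P_{A,+}^{\infty}(\lambda)$) be the result of combining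 by $\smile^-$ (resp. $\smile^+$) all the terms $$(-1)^{n-k}\,\mathrm{sign}(\sigma)\Big(\prod_{i\in\{h_1,\dots,h_k\}}a_{i,\sigma(i)}\Big)\lambda^{n-k},$$ where $0\le k\le n$, $1\le h_1<\cdots<h_k\le n$, and $\sigma$ is a permutation of $\{h_1,\dots,h_k\}$. Let $[P_{A,-}^\infty+P_{A,+}^\infty=0]=\{\lambda\in\mathbb R: P_{A,-}^\infty(\lambda)+P_{A,+}^\infty(\lambda)=0\}$. For $p\in\mathbb N$ let $\varphi_p(x)=x^{2p+1}$, a bijection of $\mathbb R$, let $\Phi_p(A)=(a_{i,j}^{2p+1})_{i,j}$, and let $\rho_A^{(p)}=\varphi_p^{-1}(\rho(\Phi_p(A)))$ be the $\varphi_p$-Perron–Frobenius eigenvalue of $A$, where $\rho$ is the spectral radius. Statement. Let $n\ge 1$ and let $A$ be a real $n\times n$ matrix all of whose entries are positive. (1) If $\lambda>0$ is a $\boxtimes$-eigenvalue of $A$, then $\lambda\in[P_{A,-}^\infty+P_{A,+}^\infty=0]$. (2) If $\lambda$ is a maximal element of $[P_{A,-}^\infty+P_{A,+}^\infty=0]$,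 then $\lambda$ is a $\boxtimes$-eigenvalue of $A$ and $\lambda=\lim_{p\to\infty}\rho_A^{(p)}$. -/

import Mathlib

open Filter Topology

namespace LimitAlgebra

noncomputable section

/-- `ξ_I[x](α)`: number of indices `i ∈ I` with `x i = α` minus number of those with
`x i = -α`. -/
def xi {ι : Type*} (I : Finset ι) (x : ι → ℝ) (α : ℝ) : ℤ :=
  ((I.filter fun i => x i = α).card : ℤ) - ((I.filter fun i => x i = -α).card : ℤ)

/-- The residual index set of `x` on `I`. -/
def residualIndex {ι : Type*} (I : Finset ι) (x : ι → ℝ) : Finset ι :=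
  I.filter fun j => xi I x (x j) ≠ 0

/-- The `n`-ary operation `⊞_{i ∈ I} x i`; it is `0` when everything cancels. -/
def boxPlus {ι : Type*} (I : Finset ι) (x : ι → ℝ) : ℝ :=
  if h : (residualIndex I x).Nonempty then
    if 0 < xi I x ((residualIndex I x).sup' h fun i => |x i|) then (residualIndex I x).sup' h x
    else if xi I x ((residualIndex I x).sup' h fun i => |x i|) < 0 then (residualIndex I x).inf' h x
    else 0
  else 0

/-- The matrix-vector product `A ⊠ v`, whose `i`-th entry is `⊞_j a_{ij} v_j`. -/
def boxMulVec {n : ℕ} (A : Matrix (Fin n) (Fin n) ℝ) (v : Fin n → ℝ) : Fin n → ℝ :=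
  fun i => boxPlus Finset.univ fun j => A i j * v j

/-- `μ > 0` is a `⊠`-eigenvalue of `A` if `A ⊠ v = μ v` for some nonzero nonnegative `v`. -/
def IsBoxEigenvalue {n : ℕ} (A : Matrix (Fin n) (Fin n) ℝ) (μ : ℝ) : Prop :=
  0 < μ ∧ ∃ v : Fin n → ℝ, 0 ≤ v ∧ v ≠ 0 ∧ boxMulVec A v = μ • v

/-- The lower binary operation: the argument of larger absolute value, the minimum in case of
a tie. -/
def smileMinus (u v : ℝ) : ℝ :=
  if |v| < |u| then u else if |u| < |v| then v else min u v

/-- The upper binary operation: the argument of larger absolute value, the maximum in case of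
a tie. -/
def smilePlus (u v : ℝ) : ℝ :=
  if |v| < |u| then u else if |u| < |v| then v else max u v

theorem smileMinus_comm (u v : ℝ) : smileMinus u v = smileMinus v u := by
  unfold smileMinus
  grind

theorem smilePlus_comm (u v : ℝ) : smilePlus u v = smilePlus v u := by
  unfold smilePlus
  grind

theorem smileMinus_assoc (u v w : ℝ) :
    smileMinus (smileMinus u v) w = smileMinus u (smileMinus v w) := by
  have key : ∀ a b : ℝ, (smileMinus a b = a ∧ (|b| < |a| ∨ |a| = |b| ∧ a ≤ b)) ∨
      (smileMinus a b = b ∧ (|a| < |b| ∨ |a| = |b| ∧ b ≤ a)) := by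
    intro a b
    unfold smileMinus
    rcases lt_trichotomy |a| |b| with h | h | h
    · simp [h, h.not_gt]
    · rcases le_total a b with h' | h' <;> simp [h, h']
    · simp [h]
  have h1 := key u v
  have h2 := key v w
  have h3 := key u w
  have h4 := key (smileMinus u v) w
  have h5 := key u (smileMinus v w)
  rcases h1 with ⟨e1, h1⟩ | ⟨e1, h1⟩ <;> rcases h2 with ⟨e2, h2⟩ | ⟨e2, h2⟩ <;>
    simp only [e1, e2] at h4 h5 ⊢ <;> grind

theorem smilePlus_assoc (u v w : ℝ) :
    smilePlus (smilePlus u v) w = smilePlus u (smilePlus v w) := by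
  have key : ∀ a b : ℝ, (smilePlus a b = a ∧ (|b| < |a| ∨ |a| = |b| ∧ b ≤ a)) ∨
      (smilePlus a b = b ∧ (|a| < |b| ∨ |a| = |b| ∧ a ≤ b)) := by
    intro a b
    unfold smilePlus
    rcases lt_trichotomy |a| |b| with h | h | h
    · simp [h, h.not_gt]
    · rcases le_total a b with h' | h' <;> simp [h, h']
    · simp [h]
  have h1 := key u v
  have h2 := key v w
  have h3 := key u w
  have h4 := key (smilePlus u v) w
  have h5 := key u (smilePlus v w)
  rcases h1 with ⟨e1, h1⟩ | ⟨e1, h1⟩ <;> rcases h2 with ⟨e2, h2⟩ | ⟨e2, h2⟩ <;>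
    simp only [e1, e2] at h4 h5 ⊢ <;> grind

instance : Std.Commutative smileMinus := ⟨smileMinus_comm⟩

instance : Std.Associative smileMinus := ⟨smileMinus_assoc⟩

instance : Std.Commutative smilePlus := ⟨smilePlus_comm⟩

instance : Std.Associative smilePlus := ⟨smilePlus_assoc⟩

/-- The index set of the characteristic polynomials: a subset `s = {h₁ < ⋯ < h_k}` of the
indices together with a permutation of `s`. -/
abbrev CharIndex (n : ℕ) : Type :=
  Σ s : Finset (Fin n), Equiv.Perm s

/-- The term `(-1)^(n-k) (sign σ ∏_{i ∈ s} a_{i,σ(i)}) μ^(n-k)`, where `k` is the cardinality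
of `s`. -/
def charTerm {n : ℕ} (A : Matrix (Fin n) (Fin n) ℝ) (μ : ℝ) (c : CharIndex n) : ℝ :=
  (-1) ^ (n - c.1.card) * (((Equiv.Perm.sign c.2 : ℤ) : ℝ) * ∏ i : c.1, A i (c.2 i)) *
    μ ^ (n - c.1.card)

/-- The lower characteristic polynomial. The family of terms is nonempty, and `0` is neutral for
`smileMinus`, so that the starting value of the fold plays no role. -/
def charLower {n : ℕ} (A : Matrix (Fin n) (Fin n) ℝ) (μ : ℝ) : ℝ :=
  (Finset.univ : Finset (CharIndex n)).fold smileMinus 0 (charTerm A μ)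

/-- The upper characteristic polynomial. -/
def charUpper {n : ℕ} (A : Matrix (Fin n) (Fin n) ℝ) (μ : ℝ) : ℝ :=
  (Finset.univ : Finset (CharIndex n)).fold smilePlus 0 (charTerm A μ)

/-- The set of real zeros of the sum of the lower and the upper characteristic polynomials. -/
def charZeroSet {n : ℕ} (A : Matrix (Fin n) (Fin n) ℝ) : Set ℝ :=
  {μ | charLower A μ + charUpper A μ = 0}

theorem pow_odd_bijective (p : ℕ) : Function.Bijective fun x : ℝ => x ^ (2 * p + 1) := by
  have hodd : Odd (2 * p + 1) := odd_two_mul_add_one p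
  refine ⟨hodd.strictMono_pow.injective, fun y => ?_⟩
  rcases le_total 0 y with hy | hy
  · exact ⟨y ^ (((2 * p + 1 : ℕ) : ℝ)⁻¹), Real.rpow_inv_natCast_pow hy (by omega)⟩
  · refine ⟨-((-y) ^ (((2 * p + 1 : ℕ) : ℝ)⁻¹)), ?_⟩
    change (-((-y) ^ (((2 * p + 1 : ℕ) : ℝ)⁻¹))) ^ (2 * p + 1) = y
    rw [hodd.neg_pow, Real.rpow_inv_natCast_pow (by linarith) (by omega), neg_neg]

/-- The bijection `φ_p : ℝ → ℝ`, `x ↦ x^(2p+1)`. -/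
def phi (p : ℕ) : ℝ ≃ ℝ :=
  Equiv.ofBijective (fun x : ℝ => x ^ (2 * p + 1)) (pow_odd_bijective p)

/-- The spectral radius of a real square matrix: the largest modulus of its complex
eigenvalues. -/
def specRadius {n : ℕ} (M : Matrix (Fin n) (Fin n) ℝ) : ℝ :=
  (spectralRadius ℂ (M.map fun a : ℝ => (a : ℂ))).toReal

/-- The `φ_p`-Perron-Frobenius eigenvalue `φ_p⁻¹(ρ(Φ_p(A)))`, where `Φ_p(A)` applies `φ_p` to
every entry of `A`. -/
def perronEigenvalue {n : ℕ} (p : ℕ) (A : Matrix (Fin n) (Fin n) ℝ) : ℝ :=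
  (phi p).symm (specRadius (A.map (phi p)))

end

end LimitAlgebra

namespace LimitAlgebra

/-! Nothing cancels in `A ⊠ v` when `A` is positive and `v` nonnegative, so the eigenproblem is the
max-times one: `a_ij w_j ≤ μ w_i` for all `i, j`, with equality somewhere in each row, and `w > 0`.
Multiplied along a permutation of a subset `s`, these inequalities lose `w` and leave `∏ a_{i,σ(i)}
≤ μ^|s|`, with equality on a cycle of tight entries.

At `μ` every term of the characteristic polynomials is thus at most `μ^n` in absolute value. The
term of `∅` and that of a tight cycle attain this bound with opposite signs, so the lower and upper
values cancel (`IsMaxEigenpair.mem_charZeroSet`). For `ν > μ` the term of `∅` dominates strictly, so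
`ν` is no zero (`IsMaxEigenpair.notMem_charZeroSet`). A max-times eigenpair always exists
(`exists_isMaxEigenpair`), so a maximal zero must be its eigenvalue.

For the limit, `w_i^(2p+1)` is a Collatz–Wielandt test vector for `Φ_p(A)`. It places the spectral
radius between `μ^(2p+1)` and `n μ^(2p+1)`, and `n^(1/(2p+1)) → 1`. -/

/-! ### Reduction to max-times eigenpairs. -/

/-- For a nonnegative family, `⊞` is the maximum. -/
theorem boxPlus_eq_sup' {ι : Type*} [DecidableEq ι] (I : Finset ι) (hI : I.Nonempty) (x : ι → ℝ)
    (hx : ∀ i, 0 ≤ x i) : boxPlus I x = I.sup' hI x := by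
  have hmem : ∀ i, i ∈ residualIndex I x ↔ i ∈ I ∧ 0 < x i := by
    intro i
    unfold residualIndex
    rw [Finset.mem_filter]
    refine and_congr_right fun hi => ?_
    rcases (hx i).eq_or_lt with h | h
    · simp [xi, ← h]
    · have h2 : (I.filter fun j => x j = -x i) = ∅ :=
        Finset.filter_eq_empty_iff.2 fun j _ hj => by linarith [hx j]
      have h1 : (I.filter fun j => x j = x i) ≠ ∅ :=
        Finset.nonempty_iff_ne_empty.1 ⟨i, by simp [hi]⟩
      simp [xi, h2, h, h1]
  unfold boxPlus
  split_ifs with h h1 h2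
  · apply le_antisymm
    · exact Finset.sup'_le _ _ fun i hi => Finset.le_sup' x ((hmem i).1 hi).1
    · obtain ⟨j, hj⟩ := h
      refine Finset.sup'_le _ _ fun i hi => ?_
      by_cases hp : 0 < x i
      · exact Finset.le_sup' x ((hmem i).2 ⟨hi, hp⟩)
      · exact (not_lt.1 hp).trans (((hmem j).1 hj).2.le.trans (Finset.le_sup' x hj))
  -- When residual indices exist, the largest value `m` is positive and `-m` is not attained, so
  -- `ξ(m) > 0` and the other two branches are void. The `try` leaves the goal with no residual
  -- index untouched.
  all_goals try
    exfalso
    obtain ⟨j, hj, hje⟩ := Finset.exists_mem_eq_sup' h fun i => |x i|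
    rw [hje, abs_of_nonneg (hx j)] at h1
    have hpos := ((hmem j).1 hj).2
    have h2 : (I.filter fun i => x i = -x j) = ∅ :=
      Finset.filter_eq_empty_iff.2 fun i _ hi => by linarith [hx i]
    have h3 : 0 < (I.filter fun i => x i = x j).card :=
      Finset.card_pos.2 ⟨j, by simp [((hmem j).1 hj).1]⟩
    apply h1
    simp only [xi, h2, Finset.card_empty]
    omega
  · have h0 : ∀ i ∈ I, x i = 0 := fun i hi => by
      by_contra hne
      exact h ⟨i, (hmem i).2 ⟨hi, (hx i).lt_of_ne' hne⟩⟩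
    obtain ⟨i, hi, hie⟩ := Finset.exists_mem_eq_sup' hI x
    rw [hie, h0 i hi]

/-- `w` is a positive eigenvector of `A` in the max-times semiring, with eigenvalue `μ`. -/
structure IsMaxEigenpair {n : ℕ} (A : Matrix (Fin n) (Fin n) ℝ) (μ : ℝ) (w : Fin n → ℝ) :
    Prop where
  pos : 0 < μ
  vec_pos : ∀ i, 0 < w i
  le : ∀ i j, A i j * w j ≤ μ * w i
  tight : ∀ i, ∃ j, A i j * w j = μ * w i

theorem IsMaxEigenpair.isBoxEigenvalue {n : ℕ} [NeZero n] {A : Matrix (Fin n) (Fin n) ℝ}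
    (hA : ∀ i j, 0 < A i j) {μ : ℝ} {w : Fin n → ℝ} (h : IsMaxEigenpair A μ w) :
    IsBoxEigenvalue A μ := by
  refine ⟨h.pos, w, fun i => (h.vec_pos i).le, fun h0 => ?_, funext fun i => ?_⟩
  · have := h.vec_pos 0
    simp [h0] at this
  · have hx : ∀ j, 0 ≤ A i j * w j := fun j => (mul_pos (hA i j) (h.vec_pos j)).le
    obtain ⟨j, hj⟩ := h.tight i
    rw [boxMulVec, boxPlus_eq_sup' _ Finset.univ_nonempty _ hx, Pi.smul_apply, smul_eq_mul]
    refine le_antisymm (Finset.sup'_le _ _ fun j _ => h.le i j) ?_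
    rw [← hj]
    exact Finset.le_sup' (fun j => A i j * w j) (Finset.mem_univ j)

/-- Since all entries are positive, one positive coordinate `w k` already forces `μ w_i ≥ a_ik w_k >
0` for every `i`. -/
theorem IsBoxEigenvalue.exists_isMaxEigenpair {n : ℕ} {A : Matrix (Fin n) (Fin n) ℝ}
    (hA : ∀ i j, 0 < A i j) {μ : ℝ} (h : IsBoxEigenvalue A μ) : ∃ w, IsMaxEigenpair A μ w := by
  obtain ⟨hμ, w, hw, hne, he⟩ := h
  obtain ⟨k, hk⟩ := Function.ne_iff.1 hne
  have hkpos : 0 < w k := (hw k).lt_of_ne' hk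
  have hx : ∀ i j, 0 ≤ A i j * w j := fun i j => mul_nonneg (hA i j).le (hw j)
  have hun : (Finset.univ : Finset (Fin n)).Nonempty := ⟨k, Finset.mem_univ k⟩
  have hsup : ∀ i, Finset.univ.sup' hun (fun j => A i j * w j) = μ * w i := by
    intro i
    rw [← boxPlus_eq_sup' _ _ _ (hx i)]
    exact congrFun he i
  have hle : ∀ i j, A i j * w j ≤ μ * w i := fun i j => by
    rw [← hsup i]
    exact Finset.le_sup' (fun j => A i j * w j) (Finset.mem_univ j)
  refine ⟨w, hμ, fun i => ?_, hle, fun i => ?_⟩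
  · exact pos_of_mul_pos_right ((mul_pos (hA i k) hkpos).trans_le (hle i k)) hμ.le
  · obtain ⟨j, -, hj⟩ := Finset.exists_mem_eq_sup' hun fun j => A i j * w j
    exact ⟨j, by rw [← hsup i, hj]⟩

/-! ### Existence of a max-times eigenvector. -/

/-- A nonzero nonnegative vector with `A ⊠ v ≤ μ v` for the least possible `μ`, normalized. -/
theorem exists_minimal_subeigenvector {n : ℕ} [NeZero n] {A : Matrix (Fin n) (Fin n) ℝ}
    (hA : ∀ i j, 0 < A i j) :
    ∃ (μ : ℝ) (v : Fin n → ℝ), 0 < μ ∧ (∀ i, 0 < v i) ∧ (∀ i j, A i j * v j ≤ μ * v i) ∧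
      ∀ (ν : ℝ) (u : Fin n → ℝ), (∀ i, 0 < u i) → (∀ i j, A i j * u j ≤ ν * u i) → μ ≤ ν := by
  set C : ℝ := ∑ i, ∑ j, A i j with hC
  have hAC : ∀ i j, A i j ≤ C := fun i j =>
    (Finset.single_le_sum (fun j _ => (hA i j).le) (Finset.mem_univ j)).trans
      (Finset.single_le_sum (f := fun i => ∑ j, A i j)
        (fun i _ => Finset.sum_nonneg fun j _ => (hA i j).le) (Finset.mem_univ i))
  have hC0 : 0 < C := (hA 0 0).trans_le (hAC 0 0)
  -- Normalizing the vectors and capping the eigenvalue at `C` makes the feasible set compact. It is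
  -- nonempty because the constant vector is feasible for `C`, which bounds all entries.
  let K : Set (ℝ × (Fin n → ℝ)) := (Set.Icc 0 C ×ˢ Set.Icc 0 1) ∩
    ({x | ∑ i, x.2 i = 1} ∩ {x | ∀ i j, A i j * x.2 j ≤ x.1 * x.2 i})
  have hK : IsCompact K := by
    refine (isCompact_Icc.prod isCompact_Icc).inter_right (IsClosed.inter ?_ ?_)
    · exact isClosed_eq (by fun_prop) (by fun_prop)
    · simp only [Set.ofPred_forall]
      exact isClosed_iInter fun i => isClosed_iInter fun j =>
        isClosed_le (by fun_prop) (by fun_prop)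
  have hn : (0 : ℝ) < n := by exact_mod_cast Nat.pos_of_ne_zero (NeZero.ne n)
  have hn1 : (1 : ℝ) ≤ n := by exact_mod_cast Nat.one_le_iff_ne_zero.2 (NeZero.ne n)
  have hne : K.Nonempty := by
    refine ⟨(C, fun _ => (n : ℝ)⁻¹), ⟨⟨hC0.le, le_rfl⟩, fun i => ?_, fun i => ?_⟩, ?_, fun i j => ?_⟩
    · simp
    · exact inv_le_one_of_one_le₀ hn1
    · simp [hn.ne']
    · exact mul_le_mul_of_nonneg_right (hAC i j) (by positivity)
  obtain ⟨⟨μ, v⟩, ⟨⟨⟨hμ0, hμC⟩, hv0, hv1⟩, hsum, hle⟩, hmin⟩ :=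
    hK.exists_isMinOn hne continuous_fst.continuousOn
  simp only [Set.mem_ofPred_eq] at hμ0 hμC hv0 hv1 hsum hle
  obtain ⟨k, hk⟩ : ∃ k, 0 < v k := by
    by_contra! hcon
    have := Finset.sum_nonpos fun i (_ : i ∈ Finset.univ) => hcon i
    linarith
  have hμv : ∀ i, 0 < μ * v i := fun i => (mul_pos (hA i k) hk).trans_le (hle i k)
  refine ⟨μ, v, pos_of_mul_pos_left (hμv k) hk.le, fun i => pos_of_mul_pos_right (hμv i) hμ0, hle,
    fun ν u hu hν => ?_⟩
  rcases le_total C ν with hCν | hνC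
  · exact hμC.trans hCν
  have hS : 0 < ∑ i, u i := Finset.sum_pos (fun i _ => hu i) Finset.univ_nonempty
  have hmem : ((ν, fun i => u i / ∑ i, u i) : ℝ × (Fin n → ℝ)) ∈ K := by
    refine ⟨⟨⟨?_, hνC⟩, fun i => ?_, fun i => ?_⟩, ?_, fun i j => ?_⟩
    · exact (pos_of_mul_pos_left ((mul_pos (hA 0 0) (hu 0)).trans_le (hν 0 0)) (hu 0).le).le
    · exact (div_pos (hu i) hS).le
    · exact (div_le_one hS).2
        (Finset.single_le_sum (f := u) (fun i _ => (hu i).le) (Finset.mem_univ i))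
    · simp only [Set.mem_ofPred_eq]
      rw [← Finset.sum_div, div_self hS.ne']
    · simp only [← mul_div_assoc]
      exact div_le_div_of_nonneg_right (hν i j) hS.le
  exact hmin hmem

/-- Existence of a positive max-times eigenvector of a positive matrix. -/
theorem exists_isMaxEigenpair {n : ℕ} [NeZero n] {A : Matrix (Fin n) (Fin n) ℝ}
    (hA : ∀ i j, 0 < A i j) : ∃ μ w, IsMaxEigenpair A μ w := by
  obtain ⟨μ, v, hμ, hv, hle, hmin⟩ := exists_minimal_subeigenvector hA
  -- `T` is `x ↦ μ⁻¹ (A ⊠ x)` on nonnegative vectors. As `T v ≤ v`, its iterates at `v` decrease to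
  -- a fixed point, and only the vanishing of this limit has to be excluded.
  let T : (Fin n → ℝ) → Fin n → ℝ := fun x i =>
    Finset.univ.sup' Finset.univ_nonempty fun j => A i j * x j / μ
  have hleT : ∀ x i j, A i j * x j / μ ≤ T x i := fun x i j =>
    Finset.le_sup' (fun j => A i j * x j / μ) (Finset.mem_univ j)
  have hT : Monotone T := fun x y hxy i => Finset.sup'_le _ _ fun j _ =>
    le_trans (by have := hA i j; have := hxy j; gcongr) (hleT y i j)
  have hTc : Continuous T := continuous_pi fun i =>
    Continuous.finset_sup'_apply _ fun j _ => by fun_prop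
  have hTv : T v ≤ v := fun i => Finset.sup'_le _ _ fun j _ => by
    rw [div_le_iff₀ hμ, mul_comm (v i)]
    exact hle i j
  have hanti : Antitone fun k => T^[k] v := hT.antitone_iterate_of_map_le hTv
  have hpos : ∀ k i, 0 < T^[k] v i := by
    intro k
    induction k with
    | zero => exact hv
    | succ k ih =>
      intro i
      rw [Function.iterate_succ_apply']
      exact (div_pos (mul_pos (hA i i) (ih i)) hμ).trans_le (hleT _ i i)
  obtain ⟨w, hw⟩ : ∃ w, Tendsto (fun k => T^[k] v) atTop (𝓝 w) :=
    ⟨_, tendsto_atTop_ciInf hanti ⟨0, by rintro _ ⟨k, rfl⟩ i; exact (hpos k i).le⟩⟩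
  have hfix : T w = w := isFixedPt_of_tendsto_iterate hw hTc.continuousAt
  have hw0 : ∀ i, 0 ≤ w i := fun i =>
    ge_of_tendsto' ((continuous_apply i).continuousAt.tendsto.comp hw) fun k => (hpos k i).le
  have hwle : ∀ i j, A i j * w j ≤ μ * w i := fun i j => by
    have := hleT w i j
    rwa [hfix, div_le_iff₀ hμ, mul_comm (w i)] at this
  have hne : ∃ k, 0 < w k := by
    by_contra! hcon
    have hw0' : w = 0 := funext fun i => le_antisymm (hcon i) (hw0 i)
    have hev : ∀ᶠ k in atTop, ∀ i, T^[k] v i < v i / 2 := by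
      rw [Filter.eventually_all]
      intro i
      have := (continuous_apply i).continuousAt.tendsto.comp hw
      exact this.eventually_lt_const (by simpa [hw0'] using half_pos (hv i))
    obtain ⟨k, hk, hk1⟩ := (hev.and (eventually_ge_atTop 1)).exists
    -- With `T^k v < v / 2` and `r^k < 2`, one has `r^k T^k v ≤ v`. Hence `u = max_{l<k} r^l T^l v`
    -- satisfies `r T u ≤ u`: each term moves to the next, and the last one falls back below `v ≤
    -- u`. This makes `μ / r < μ` feasible, against minimality.
    obtain ⟨r, hr1, hrk⟩ : ∃ r : ℝ, 1 < r ∧ r ^ k < 2 := by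
      have hc : Tendsto (fun r : ℝ => r ^ k) (𝓝[>] 1) (𝓝 1) := by
        have : ContinuousAt (fun r : ℝ => r ^ k) 1 := by fun_prop
        simpa [ContinuousAt] using this.mono_left nhdsWithin_le_nhds
      obtain ⟨r, h1, h2⟩ := ((hc.eventually_lt_const (by norm_num : (1 : ℝ) < 2)).and
        self_mem_nhdsWithin).exists
      exact ⟨r, h2, h1⟩
    have hr0 : 0 < r := one_pos.trans hr1
    have hkne : (Finset.range k).Nonempty := Finset.nonempty_range_iff.2 (by omega)
    let u : Fin n → ℝ := fun i => (Finset.range k).sup' hkne fun l => r ^ l * T^[l] v i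
    have hu : ∀ l < k, ∀ i, r ^ l * T^[l] v i ≤ u i := fun l hl i =>
      Finset.le_sup' (fun l => r ^ l * T^[l] v i) (Finset.mem_range.2 hl)
    have hvu : ∀ i, v i ≤ u i := fun i => by simpa using hu 0 hk1 i
    have hmin' : μ ≤ μ / r := by
      refine hmin _ u (fun i => (hv i).trans_le (hvu i)) fun i j => ?_
      obtain ⟨l, hl, hlu⟩ := Finset.exists_mem_eq_sup' hkne fun l => r ^ l * T^[l] v j
      have hul : u j = r ^ l * T^[l] v j := hlu
      have h1 : r ^ (l + 1) * T^[l + 1] v i ≤ u i := by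
        rcases (Nat.succ_le_of_lt (Finset.mem_range.1 hl)).eq_or_lt with h | h
        · refine le_trans ?_ (hvu i)
          rw [Nat.succ_eq_add_one] at h
          rw [h]
          nlinarith [hk i, hv i, hpos k i]
        · exact hu _ h i
      have h2 := hleT (T^[l] v) i j
      rw [← Function.iterate_succ_apply' T, div_le_iff₀ hμ] at h2
      rw [hul, div_mul_eq_mul_div, le_div_iff₀ hr0]
      calc A i j * (r ^ l * T^[l] v j) * r = r ^ (l + 1) * (A i j * T^[l] v j) := by ring
        _ ≤ r ^ (l + 1) * (T^[l + 1] v i * μ) := by gcongr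
        _ = μ * (r ^ (l + 1) * T^[l + 1] v i) := by ring
        _ ≤ μ * u i := by gcongr
    exact absurd hmin' (not_le.2 (div_lt_self hμ hr1))
  obtain ⟨k, hk⟩ := hne
  refine ⟨μ, w, hμ, fun i => ?_, hwle, fun i => ?_⟩
  · exact pos_of_mul_pos_right ((mul_pos (hA i k) hk).trans_le (hwle i k)) hμ.le
  · obtain ⟨j, -, hj⟩ := Finset.exists_mem_eq_sup' (Finset.univ_nonempty (α := Fin n))
      fun j => A i j * w j / μ
    refine ⟨j, ?_⟩
    have : w i = A i j * w j / μ := by rw [← hj]; exact (congrFun hfix i).symm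
    rw [this]
    field_simp

/-! ### Values of the folds by `smileMinus` and `smilePlus`. -/

/-- Negation exchanges the two operations, so only folds of `smileMinus` need a direct analysis. -/
theorem smilePlus_eq_neg (u v : ℝ) : smilePlus u v = -smileMinus (-u) (-v) := by
  unfold smilePlus smileMinus
  simp only [abs_neg]
  split_ifs <;> simp [min_neg_neg]

theorem fold_smilePlus_eq_neg {ι : Type*} [DecidableEq ι] (s : Finset ι) (t : ι → ℝ) :
    s.fold smilePlus 0 t = -s.fold smileMinus 0 fun i => -t i := by
  induction s using Finset.induction_on with
  | empty => simp
  | insert a s ha ih => rw [Finset.fold_insert ha, Finset.fold_insert ha, smilePlus_eq_neg, ih,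
      neg_neg]

theorem smileMinus_cases (a b : ℝ) :
    (smileMinus a b = a ∧ (|b| < |a| ∨ |a| = |b| ∧ a ≤ b)) ∨
      (smileMinus a b = b ∧ (|a| < |b| ∨ |a| = |b| ∧ b ≤ a)) := by
  unfold smileMinus
  rcases lt_trichotomy |a| |b| with h | h | h
  · simp [h, h.not_gt]
  · rcases le_total a b with h' | h' <;> simp [h, h']
  · simp [h]

/-- The fold of `smileMinus` is a term of largest absolute value, and the least such. -/
theorem fold_smileMinus_spec {ι : Type*} [DecidableEq ι] (s : Finset ι) (t : ι → ℝ) :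
    (∀ i ∈ s, |t i| ≤ |s.fold smileMinus 0 t|) ∧
      (s.fold smileMinus 0 t = 0 ∨ ∃ i ∈ s, t i = s.fold smileMinus 0 t) ∧
      ∀ i ∈ s, |t i| = |s.fold smileMinus 0 t| → s.fold smileMinus 0 t ≤ t i := by
  induction s using Finset.induction_on with
  | empty => simp
  | insert a s ha ih =>
    rw [Finset.fold_insert ha]
    obtain ⟨h1, h2, h3⟩ := ih
    set F := s.fold smileMinus 0 t
    rcases smileMinus_cases (t a) F with ⟨e, h⟩ | ⟨e, h⟩ <;> rw [e]
    · refine ⟨fun i hi => ?_, Or.inr ⟨a, by simp⟩, fun i hi hie => ?_⟩ <;>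
        rcases Finset.mem_insert.1 hi with rfl | hi <;> grind
    · refine ⟨fun i hi => ?_, ?_, fun i hi hie => ?_⟩
      · rcases Finset.mem_insert.1 hi with rfl | hi <;> grind
      · rcases h2 with h2 | ⟨i, hi, h2⟩
        · exact Or.inl h2
        · exact Or.inr ⟨i, Finset.mem_insert_of_mem hi, h2⟩
      · rcases Finset.mem_insert.1 hi with rfl | hi <;> grind

/-- If `-M` occurs among the terms, and `M ≥ 0` bounds them, the fold is `-M`. -/
theorem fold_smileMinus_eq_neg {ι : Type*} [DecidableEq ι] {s : Finset ι} {t : ι → ℝ} {M : ℝ}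
    (hM : ∀ i ∈ s, |t i| ≤ M) {i : ι} (hi : i ∈ s) (hti : t i = -M) :
    s.fold smileMinus 0 t = -M := by
  obtain ⟨h1, h2, h3⟩ := fold_smileMinus_spec s t
  have hM0 : 0 ≤ M := (abs_nonneg _).trans (hM i hi)
  have hMF : M ≤ |s.fold smileMinus 0 t| := by
    have := h1 i hi
    rwa [hti, abs_neg, abs_of_nonneg hM0] at this
  have hFM : |s.fold smileMinus 0 t| ≤ M := by
    rcases h2 with h2 | ⟨j, hj, h2⟩
    · simpa [h2] using hM0
    · rw [← h2]
      exact hM j hj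
  have h := h3 i hi (by rw [hti, abs_neg, abs_of_nonneg hM0]; exact le_antisymm hMF hFM)
  exact le_antisymm (hti ▸ h) (abs_le.1 hFM).1

/-- If one term strictly dominates, it is the value of the fold. -/
theorem fold_smileMinus_eq_of_dominant {ι : Type*} [DecidableEq ι] {s : Finset ι} {t : ι → ℝ}
    {i : ι} (hi : i ∈ s) (ht : t i ≠ 0) (hlt : ∀ j ∈ s, j ≠ i → |t j| < |t i|) :
    s.fold smileMinus 0 t = t i := by
  obtain ⟨h1, h2, -⟩ := fold_smileMinus_spec s t
  have h := h1 i hi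
  rcases h2 with h2 | ⟨j, hj, h2⟩
  · rw [h2, abs_zero] at h
    exact absurd (abs_nonpos_iff.1 h) ht
  · rw [← h2] at h ⊢
    by_cases hji : j = i
    · rw [hji]
    · exact absurd h (not_le.2 (hlt j hj hji))

/-! ### Zeros of the characteristic polynomials. -/

variable {n : ℕ} {A : Matrix (Fin n) (Fin n) ℝ}

/-- Among the terms of largest absolute value, the lower polynomial picks `-M` and the upper one
`M`. -/
theorem mem_charZeroSet_of_tie {μ M : ℝ} (hM : ∀ c, |charTerm A μ c| ≤ M) {c d : CharIndex n}
    (hc : charTerm A μ c = M) (hd : charTerm A μ d = -M) : μ ∈ charZeroSet A := by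
  change charLower A μ + charUpper A μ = 0
  have h1 : charLower A μ = -M :=
    fold_smileMinus_eq_neg (fun i _ => hM i) (Finset.mem_univ d) hd
  have h2 : charUpper A μ = M := by
    rw [charUpper, fold_smilePlus_eq_neg, fold_smileMinus_eq_neg (M := M) (fun i _ => ?_)
      (Finset.mem_univ c) (by rw [hc]), neg_neg]
    rw [abs_neg]
    exact hM i
  rw [h1, h2, neg_add_cancel]

/-- Without a tie both polynomials take the value of the dominant term, so their sum is twice that
term. -/
theorem notMem_charZeroSet_of_dominant {μ : ℝ} {c : CharIndex n} (hc : charTerm A μ c ≠ 0)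
    (hlt : ∀ d, d ≠ c → |charTerm A μ d| < |charTerm A μ c|) : μ ∉ charZeroSet A := by
  change ¬(charLower A μ + charUpper A μ = 0)
  have h1 : charLower A μ = charTerm A μ c :=
    fold_smileMinus_eq_of_dominant (Finset.mem_univ c) hc fun d _ => hlt d
  have h2 : charUpper A μ = charTerm A μ c := by
    rw [charUpper, fold_smilePlus_eq_neg, fold_smileMinus_eq_of_dominant (Finset.mem_univ c)
      (neg_ne_zero.2 hc) fun d _ hd => ?_, neg_neg]
    simpa only [abs_neg] using hlt d hd
  rw [h1, h2, ← two_mul]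
  exact mul_ne_zero two_ne_zero hc

theorem abs_charTerm (hA : ∀ i j, 0 < A i j) {μ : ℝ} (hμ : 0 ≤ μ) (c : CharIndex n) :
    |charTerm A μ c| = (∏ i : c.1, A i (c.2 i)) * μ ^ (n - c.1.card) := by
  have hP : 0 ≤ ∏ i : c.1, A i (c.2 i) := Finset.prod_nonneg fun i _ => (hA _ _).le
  have hs : |((Equiv.Perm.sign c.2 : ℤ) : ℝ)| = 1 := by
    rcases Int.units_eq_one_or (Equiv.Perm.sign c.2) with h | h <;> simp [h]
  rw [charTerm, abs_mul, abs_mul, abs_mul, hs, abs_pow, abs_neg, abs_one, one_pow, one_mul, one_mul,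
    abs_of_nonneg hP, abs_of_nonneg (pow_nonneg hμ _)]

theorem charTerm_empty (μ : ℝ) : charTerm A μ ⟨∅, 1⟩ = (-1) ^ n * μ ^ n := by
  simp [charTerm]

theorem eq_empty_of_card_eq_zero {c : CharIndex n} (h : c.1.card = 0) : c = ⟨∅, 1⟩ := by
  obtain ⟨s, σ⟩ := c
  obtain rfl : s = ∅ := Finset.card_eq_zero.1 h
  exact congrArg _ (Subsingleton.elim _ _)

/-- The permutation maps the subset onto itself, so the weights `w` on the two sides have the same
product and cancel. -/
theorem IsMaxEigenpair.prod_le {μ : ℝ} {w : Fin n → ℝ} (h : IsMaxEigenpair A μ w)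
    (hA : ∀ i j, 0 < A i j) (c : CharIndex n) :
    ∏ i : c.1, A i (c.2 i) ≤ μ ^ c.1.card := by
  have hW : 0 < ∏ i : c.1, w i := Finset.prod_pos fun i _ => h.vec_pos i
  refine le_of_mul_le_mul_right ?_ hW
  calc (∏ i : c.1, A i (c.2 i)) * ∏ i : c.1, w i
      = ∏ i : c.1, A i (c.2 i) * w (c.2 i) := by
        rw [Finset.prod_mul_distrib, Equiv.prod_comp c.2 fun i : c.1 => w i]
    _ ≤ ∏ i : c.1, μ * w i := Finset.prod_le_prod
        (fun i _ => (mul_pos (hA _ _) (h.vec_pos _)).le) fun i _ => h.le _ _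
    _ = μ ^ c.1.card * ∏ i : c.1, w i := by simp [Finset.prod_mul_distrib]

theorem IsMaxEigenpair.prod_eq {μ : ℝ} {w : Fin n → ℝ} (h : IsMaxEigenpair A μ w)
    (c : CharIndex n) (hc : ∀ i : c.1, A i (c.2 i) * w (c.2 i) = μ * w i) :
    ∏ i : c.1, A i (c.2 i) = μ ^ c.1.card := by
  have hW : 0 < ∏ i : c.1, w i := Finset.prod_pos fun i _ => h.vec_pos i
  refine mul_right_cancel₀ hW.ne' ?_
  calc (∏ i : c.1, A i (c.2 i)) * ∏ i : c.1, w i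
      = ∏ i : c.1, A i (c.2 i) * w (c.2 i) := by
        rw [Finset.prod_mul_distrib, Equiv.prod_comp c.2 fun i : c.1 => w i]
    _ = ∏ i : c.1, μ * w i := Finset.prod_congr rfl fun i _ => hc i
    _ = μ ^ c.1.card * ∏ i : c.1, w i := by simp [Finset.prod_mul_distrib]

/-- A self-map of a nonempty finite type restricts to a cyclic permutation of some subset. -/
theorem exists_cyclic_perm {α : Type*} [Fintype α] [DecidableEq α] [Nonempty α] (f : α → α) :
    ∃ (s : Finset α) (σ : Equiv.Perm s), (∀ i : s, (σ i : α) = f i) ∧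
      (Equiv.Perm.sign σ : ℤ) = -(-1) ^ s.card := by
  classical
  -- `f` permutes its periodic points. Extended by the identity, this permutation has the cycle
  -- through a periodic point as the desired restriction.
  let e : Equiv.Perm (Function.periodicPts f) := (Function.bijOn_periodicPts f).equiv f
  let τ : Equiv.Perm α := Equiv.Perm.ofSubtype e
  have hτ : ∀ x ∈ Function.periodicPts f, τ x = f x := fun x hx =>
    Equiv.Perm.ofSubtype_apply_of_mem e hx
  have hτ' : ∀ x ∉ Function.periodicPts f, τ x = x := fun x hx =>
    Equiv.Perm.ofSubtype_apply_of_not_mem e hx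
  obtain ⟨x, hx⟩ : ∃ x, x ∈ Function.periodicPts f := by
    obtain ⟨y⟩ := ‹Nonempty α›
    obtain ⟨k, l, hkl, he⟩ := Finite.exists_ne_map_eq_of_infinite fun k : ℕ => f^[k] y
    wlog hlt : k < l generalizing k l
    · exact this l k hkl.symm he.symm (by omega)
    refine ⟨f^[k] y, Function.mk_mem_periodicPts (n := l - k) (by omega) ?_⟩
    change f^[l - k] (f^[k] y) = f^[k] y
    rw [← Function.iterate_add_apply, Nat.sub_add_cancel hlt.le]
    exact he.symm
  -- A fixed point gives a loop of length one, which `IsCycle` does not cover.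
  by_cases hfx : f x = x
  · refine ⟨{x}, 1, fun i => ?_, by simp⟩
    have : (i : α) = x := Finset.mem_singleton.1 i.2
    simp [this, hfx]
  · have hcyc : (τ.cycleOf x).IsCycle := Equiv.Perm.isCycle_cycleOf τ (by rwa [hτ x hx])
    refine ⟨(τ.cycleOf x).support,
      (τ.cycleOf x).subtypePerm fun y => Equiv.Perm.apply_mem_support, fun i => ?_, ?_⟩
    · have hi := (Equiv.Perm.mem_support_cycleOf_iff.1 i.2)
      rw [Equiv.Perm.subtypePerm_apply]
      change τ.cycleOf x i = f i
      rw [hi.1.cycleOf_apply]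
      refine hτ _ ?_
      by_contra hcon
      exact Equiv.Perm.mem_support.1 (Equiv.Perm.support_cycleOf_le τ x i.2) (hτ' _ hcon)
    · have hs := Equiv.Perm.sign_subtypePerm (τ.cycleOf x)
        (p := fun y => y ∈ (τ.cycleOf x).support) (fun y => Equiv.Perm.apply_mem_support)
        fun y hy => Equiv.Perm.mem_support.2 hy
      rw [hcyc.sign] at hs
      refine Eq.trans (congrArg _ (Eq.trans ?_ hs)) (by simp)
      congr!

/-- Choosing a tight column in each row defines a self-map `f`, which contains a cycle. If its
length is `k`, its sign is `-(-1)^k`, so its term is `-(-1)^n μ^n`, opposite to the term of `∅`. -/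
theorem IsMaxEigenpair.mem_charZeroSet [NeZero n] {μ : ℝ} {w : Fin n → ℝ}
    (h : IsMaxEigenpair A μ w) (hA : ∀ i j, 0 < A i j) : μ ∈ charZeroSet A := by
  choose f hf using h.tight
  obtain ⟨s, σ, hσ, hsign⟩ := exists_cyclic_perm f
  have hcard : ∀ c : CharIndex n, c.1.card ≤ n := fun c => by
    simpa using Finset.card_le_univ c.1
  have hbound : ∀ c, |charTerm A μ c| ≤ μ ^ n := fun c => by
    rw [abs_charTerm hA h.pos.le]
    calc _ ≤ μ ^ c.1.card * μ ^ (n - c.1.card) :=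
          mul_le_mul_of_nonneg_right (h.prod_le hA c) (pow_nonneg h.pos.le _)
      _ = μ ^ n := by rw [← pow_add, Nat.add_sub_cancel' (hcard c)]
  have he := charTerm_empty (A := A) μ
  have hs : charTerm A μ ⟨s, σ⟩ = -((-1) ^ n * μ ^ n) := by
    have hp := h.prod_eq ⟨s, σ⟩ fun i => by
      change A i (σ i) * w (σ i) = μ * w i
      rw [hσ, hf]
    have hsn := hcard ⟨s, σ⟩
    simp only at hp hsn
    have hpow : ∀ x : ℝ, x ^ n = x ^ (n - s.card) * x ^ s.card := fun x => by
      rw [← pow_add, Nat.sub_add_cancel hsn]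
    simp only [charTerm]
    rw [hp, hsign, hpow, hpow]
    push_cast
    ring
  -- The parity of `n` decides which of the two extremal terms is positive.
  rcases neg_one_pow_eq_or ℝ n with h1 | h1 <;> rw [h1] at he hs
  · exact mem_charZeroSet_of_tie hbound (by rw [he, one_mul]) (by rw [hs, one_mul])
  · exact mem_charZeroSet_of_tie hbound (by rw [hs]; ring) (by rw [he, neg_one_mul])

/-- A nonempty subset of size `k` contributes at most `μ^k ν^(n-k) < ν^n`. -/
theorem IsMaxEigenpair.notMem_charZeroSet {μ ν : ℝ} {w : Fin n → ℝ}
    (h : IsMaxEigenpair A μ w) (hA : ∀ i j, 0 < A i j) (hν : μ < ν) : ν ∉ charZeroSet A := by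
  have hν0 : 0 < ν := h.pos.trans hν
  refine notMem_charZeroSet_of_dominant (c := ⟨∅, 1⟩) ?_ fun d hd => ?_
  · rw [charTerm_empty]
    exact mul_ne_zero (pow_ne_zero _ (by norm_num)) (pow_ne_zero _ hν0.ne')
  · have hd0 : d.1.card ≠ 0 := fun h0 => hd (eq_empty_of_card_eq_zero h0)
    have hdn : d.1.card ≤ n := by simpa using Finset.card_le_univ d.1
    rw [abs_charTerm hA hν0.le, abs_charTerm hA hν0.le]
    calc _ ≤ μ ^ d.1.card * ν ^ (n - d.1.card) :=
          mul_le_mul_of_nonneg_right (h.prod_le hA d) (pow_nonneg hν0.le _)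
      _ < ν ^ d.1.card * ν ^ (n - d.1.card) :=
          mul_lt_mul_of_pos_right (pow_lt_pow_left₀ hν h.pos.le hd0) (pow_pos hν0 _)
      _ = ν ^ n := by rw [← pow_add, Nat.add_sub_cancel' hdn]
      _ = _ := by simp

theorem charZeroSet_eq_empty (A : Matrix (Fin 0) (Fin 0) ℝ) : charZeroSet A = ∅ := by
  refine Set.eq_empty_of_forall_notMem fun μ =>
    notMem_charZeroSet_of_dominant (c := ⟨∅, 1⟩) (by simp [charTerm_empty]) fun d hd => ?_
  exact absurd (eq_empty_of_card_eq_zero (by simpa using Finset.card_le_univ d.1)) hd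

/-! ### Spectral radius bounds and the limit of the Perron–Frobenius eigenvalues. -/

/-- Collatz–Wielandt upper bound: `B w ≤ r w` with `w > 0` bounds the spectral radius of `B ≥ 0`
by `r`. -/
theorem spectralRadius_le_of_mulVec_le {B : Matrix (Fin n) (Fin n) ℝ} (hB : ∀ i j, 0 ≤ B i j)
    {w : Fin n → ℝ} (hw : ∀ i, 0 < w i) {r : ℝ}
    (h : ∀ i, ∑ j, B i j * w j ≤ r * w i) :
    spectralRadius ℂ (B.map fun a : ℝ => (a : ℂ)) ≤ ENNReal.ofReal r := by
  refine iSup₂_le fun z hz => ?_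
  rw [← Matrix.spectrum_toLin', ← Module.End.hasEigenvalue_iff_mem_spectrum] at hz
  obtain ⟨x, hx⟩ := hz.exists_hasEigenvector
  have hxe : ∀ i, ∑ j, (B i j : ℂ) * x j = z * x i := fun i => by
    have := congrFun hx.apply_eq_smul i
    simpa [Matrix.toLin'_apply, Matrix.mulVec, dotProduct] using this
  obtain ⟨k, hk⟩ := Function.ne_iff.1 hx.2
  -- The eigenvalue equation is read at the row where `|x_i| / w_i` is largest; there `|x| ≤ (|x_m|
  -- / w_m) w` bounds the whole sum.
  obtain ⟨m, -, hm⟩ := Finset.exists_max_image Finset.univ (fun i => ‖x i‖ / w i)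
    ⟨k, Finset.mem_univ k⟩
  have hle : ∀ j, ‖x j‖ ≤ ‖x m‖ / w m * w j := fun j =>
    (div_le_iff₀ (hw j)).1 (hm j (Finset.mem_univ j))
  have hxm : 0 < ‖x m‖ := by
    have h1 : 0 < ‖x k‖ / w k := div_pos (norm_pos_iff.2 hk) (hw k)
    have h2 := h1.trans_le (hm k (Finset.mem_univ k))
    exact (div_pos_iff_of_pos_right (hw m)).1 h2
  have hnorm : ‖z‖ * ‖x m‖ ≤ r * ‖x m‖ := by
    calc ‖z‖ * ‖x m‖ = ‖∑ j, (B m j : ℂ) * x j‖ := by rw [hxe, norm_mul]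
      _ ≤ ∑ j, B m j * ‖x j‖ := (norm_sum_le _ _).trans_eq <| Finset.sum_congr rfl fun j _ => by
          rw [norm_mul, Complex.norm_real, Real.norm_of_nonneg (hB m j)]
      _ ≤ ∑ j, B m j * (‖x m‖ / w m * w j) :=
          Finset.sum_le_sum fun j _ => mul_le_mul_of_nonneg_left (hle j) (hB m j)
      _ = ‖x m‖ / w m * ∑ j, B m j * w j := by
          rw [Finset.mul_sum]
          exact Finset.sum_congr rfl fun j _ => by ring
      _ ≤ ‖x m‖ / w m * (r * w m) :=
          mul_le_mul_of_nonneg_left (h m) (div_nonneg hxm.le (hw m).le)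
      _ = r * ‖x m‖ := by
          have := (hw m).ne'
          field_simp
  have hz' : ‖z‖ ≤ r := le_of_mul_le_mul_right hnorm hxm
  rw [← ENNReal.ofReal_coe_nnreal]
  exact ENNReal.ofReal_le_ofReal hz'

/-- Collatz–Wielandt lower bound: `r w ≤ B w` with `w > 0` bounds the spectral radius of `B ≥ 0`
from below by `r`. -/
theorem le_spectralRadius_of_le_mulVec [NeZero n] {B : Matrix (Fin n) (Fin n) ℝ}
    (hB : ∀ i j, 0 ≤ B i j) {w : Fin n → ℝ} (hw : ∀ i, 0 < w i) {r : ℝ} (hr : 0 ≤ r)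
    (h : ∀ i, r * w i ≤ ∑ j, B i j * w j) :
    ENNReal.ofReal r ≤ spectralRadius ℂ (B.map fun a : ℝ => (a : ℂ)) := by
  let _ : NormedRing (Matrix (Fin n) (Fin n) ℂ) := Matrix.linftyOpNormedRing
  let _ : NormedAlgebra ℂ (Matrix (Fin n) (Fin n) ℂ) := Matrix.linftyOpNormedAlgebra
  have _ : CompleteSpace (Matrix (Fin n) (Fin n) ℂ) := FiniteDimensional.complete ℂ _
  set C : Matrix (Fin n) (Fin n) ℂ := B.map fun a : ℝ => (a : ℂ) with hC
  -- Iteration gives `B^k w ≥ r^k w`, so `‖B^k‖ ≥ r^k`, and Gelfand's formula concludes. The vector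
  -- `y` records that `C^k w` stays real, so that it can be compared coordinatewise.
  have hpow : ∀ k, ∃ y : Fin n → ℝ, (C ^ k).mulVec (fun i => (w i : ℂ)) = (fun i => (y i : ℂ)) ∧
      ∀ i, r ^ k * w i ≤ y i := by
    intro k
    induction k with
    | zero => exact ⟨w, by simp, by simp⟩
    | succ k ih =>
      obtain ⟨y, hy, hle⟩ := ih
      refine ⟨B.mulVec y, ?_, fun i => ?_⟩
      · rw [pow_succ', ← Matrix.mulVec_mulVec, hy]
        ext i
        simp [hC, Matrix.mulVec, dotProduct]
      · calc r ^ (k + 1) * w i = r ^ k * (r * w i) := by ring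
          _ ≤ r ^ k * ∑ j, B i j * w j := mul_le_mul_of_nonneg_left (h i) (pow_nonneg hr k)
          _ = ∑ j, B i j * (r ^ k * w j) := by
              rw [Finset.mul_sum]
              exact Finset.sum_congr rfl fun j _ => by ring
          _ ≤ ∑ j, B i j * y j :=
              Finset.sum_le_sum fun j _ => mul_le_mul_of_nonneg_left (hle j) (hB i j)
  have hnorm : ∀ k, r ^ k ≤ ‖C ^ k‖ := by
    intro k
    obtain ⟨y, hy, hle⟩ := hpow k
    have hwn : 0 < ‖fun i => (w i : ℂ)‖ := norm_pos_iff.2 fun h0 => by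
      have := congrFun h0 0
      simp [(hw 0).ne'] at this
    refine le_of_mul_le_mul_right (le_trans ?_ (Matrix.linfty_opNorm_mulVec (C ^ k) _)) hwn
    rw [hy]
    have hrk := pow_nonneg hr k
    have : r ^ k * ‖fun i => (w i : ℂ)‖ = ‖fun i => ((r ^ k * w i : ℝ) : ℂ)‖ := by
      have h1 : (fun i => ((r ^ k * w i : ℝ) : ℂ)) = ((r ^ k : ℝ) : ℂ) • fun i => (w i : ℂ) := by
        ext i
        simp
      rw [h1, norm_smul, Complex.norm_real, Real.norm_of_nonneg hrk]
    rw [this]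
    refine (pi_norm_le_iff_of_nonneg (norm_nonneg _)).2 fun i => ?_
    refine le_trans ?_ (norm_le_pi_norm (fun i => (y i : ℂ)) i)
    have h0 : 0 ≤ r ^ k * w i := mul_nonneg hrk (hw i).le
    rw [Complex.norm_real, Complex.norm_real, Real.norm_of_nonneg h0,
      Real.norm_of_nonneg (h0.trans (hle i))]
    exact hle i
  refine ge_of_tendsto (spectrum.pow_norm_pow_one_div_tendsto_nhds_spectralRadius C) ?_
  filter_upwards [eventually_ge_atTop 1] with k hk
  refine ENNReal.ofReal_le_ofReal ?_
  have hk0 : k ≠ 0 := by omega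
  calc r = (r ^ k) ^ (1 / (k : ℝ)) := by rw [one_div, Real.pow_rpow_inv_natCast hr hk0]
    _ ≤ ‖C ^ k‖ ^ (1 / (k : ℝ)) :=
        Real.rpow_le_rpow (pow_nonneg hr k) (hnorm k) (by positivity)

/-- With the test vector `w_i^(2p+1)`, each of the `n` summands in a row is at most `μ^(2p+1)
w_i^(2p+1)`, and the tight one alone attains this value. -/
theorem IsMaxEigenpair.specRadius_map_phi [NeZero n] {μ : ℝ} {w : Fin n → ℝ}
    (h : IsMaxEigenpair A μ w) (hA : ∀ i j, 0 < A i j) (p : ℕ) :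
    μ ^ (2 * p + 1) ≤ specRadius (A.map (phi p)) ∧
      specRadius (A.map (phi p)) ≤ n * μ ^ (2 * p + 1) := by
  have hphi : ∀ x, phi p x = x ^ (2 * p + 1) := fun x => rfl
  have hB : ∀ i j, 0 ≤ (A.map (phi p)) i j := fun i j => pow_nonneg (hA i j).le _
  have hw : ∀ i, 0 < w i ^ (2 * p + 1) := fun i => pow_pos (h.vec_pos i) _
  have hq : 0 ≤ μ ^ (2 * p + 1) := pow_nonneg h.pos.le _
  have hnq : 0 ≤ n * μ ^ (2 * p + 1) := mul_nonneg n.cast_nonneg hq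
  have hup := spectralRadius_le_of_mulVec_le (r := n * μ ^ (2 * p + 1)) hB hw fun i => by
    calc _ ≤ ∑ _j : Fin n, μ ^ (2 * p + 1) * w i ^ (2 * p + 1) := by
          refine Finset.sum_le_sum fun j _ => ?_
          rw [Matrix.map_apply, hphi, ← mul_pow, ← mul_pow]
          exact pow_le_pow_left₀ (mul_pos (hA i j) (h.vec_pos j)).le (h.le i j) _
      _ = _ := by simp [mul_assoc]
  have hlow := le_spectralRadius_of_le_mulVec hB hw hq fun i => by
    obtain ⟨j, hj⟩ := h.tight i
    calc _ = (A.map (phi p)) i j * w j ^ (2 * p + 1) := by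
          rw [Matrix.map_apply, hphi, ← mul_pow, ← mul_pow, hj]
      _ ≤ _ := Finset.single_le_sum (f := fun j => (A.map (phi p)) i j * w j ^ (2 * p + 1))
          (fun j _ => mul_nonneg (hB i j) (hw j).le) (Finset.mem_univ j)
  exact ⟨(ENNReal.ofReal_le_iff_le_toReal (ne_top_of_le_ne_top ENNReal.ofReal_ne_top hup)).1 hlow,
    ENNReal.toReal_le_of_le_ofReal hnq hup⟩

theorem IsMaxEigenpair.tendsto_perronEigenvalue [NeZero n] {μ : ℝ} {w : Fin n → ℝ}
    (h : IsMaxEigenpair A μ w) (hA : ∀ i j, 0 < A i j) :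
    Tendsto (fun p => perronEigenvalue p A) atTop (𝓝 μ) := by
  have hpow : ∀ p, perronEigenvalue p A ^ (2 * p + 1) = specRadius (A.map (phi p)) := fun p =>
    (phi p).apply_symm_apply _
  have hlow : ∀ p, μ ≤ perronEigenvalue p A := fun p =>
    (odd_two_mul_add_one p).strictMono_pow.le_iff_le.1
      ((h.specRadius_map_phi hA p).1.trans_eq (hpow p).symm)
  have hup : ∀ p : ℕ, perronEigenvalue p A ≤ (n : ℝ) ^ (((2 * p + 1 : ℕ) : ℝ)⁻¹) * μ := fun p => by
    refine (odd_two_mul_add_one p).strictMono_pow.le_iff_le.1 ?_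
    change perronEigenvalue p A ^ (2 * p + 1) ≤ _ ^ (2 * p + 1)
    rw [hpow, mul_pow, Real.rpow_inv_natCast_pow n.cast_nonneg (by omega)]
    exact (h.specRadius_map_phi hA p).2
  refine tendsto_of_tendsto_of_tendsto_of_le_of_le tendsto_const_nhds ?_ hlow hup
  have hn : (n : ℝ) ≠ 0 := Nat.cast_ne_zero.2 (NeZero.ne n)
  have hexp : Tendsto (fun p : ℕ => (((2 * p + 1 : ℕ) : ℝ)⁻¹)) atTop (𝓝 0) :=
    tendsto_inv_atTop_zero.comp <| tendsto_natCast_atTop_atTop.comp <|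
      tendsto_atTop_mono (fun p : ℕ => (by omega : p ≤ 2 * p + 1)) tendsto_id
  have := (tendsto_const_nhds (x := (n : ℝ))).rpow hexp (Or.inl hn)
  simpa using this.mul_const μ

end LimitAlgebra

theorem mainTheorem12 (n : ℕ) (A : Matrix (Fin n) (Fin n) ℝ) (hA : ∀ i j, 0 < A i j) :
    (∀ μ : ℝ, 0 < μ → LimitAlgebra.IsBoxEigenvalue A μ → μ ∈ LimitAlgebra.charZeroSet A) ∧
    (∀ μ : ℝ, Maximal (fun x : ℝ => x ∈ LimitAlgebra.charZeroSet A) μ →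
      LimitAlgebra.IsBoxEigenvalue A μ ∧
      Tendsto (fun p : ℕ => LimitAlgebra.perronEigenvalue p A) atTop (𝓝 μ)) := by
  rcases Nat.eq_zero_or_pos n with rfl | hn
  · refine ⟨fun μ _ ⟨_, v, _, hv, _⟩ => absurd (Subsingleton.elim v 0) hv, fun μ hμ => ?_⟩
    have := hμ.prop
    simp [LimitAlgebra.charZeroSet_eq_empty] at this
  have : NeZero n := ⟨hn.ne'⟩
  refine ⟨fun μ _ hμ => ?_, fun μ hμ => ?_⟩
  · obtain ⟨w, hw⟩ := hμ.exists_isMaxEigenpair hA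
    exact hw.mem_charZeroSet hA
  · obtain ⟨ν, w, hw⟩ := LimitAlgebra.exists_isMaxEigenpair hA
    have hle : μ ≤ ν := not_lt.1 fun hlt => hw.notMem_charZeroSet hA hlt hμ.prop
    -- The order is total, so a maximal zero is the greatest one; as `ν` is itself a zero, the two
    -- agree.
    obtain rfl : μ = ν := le_antisymm hle (hμ.le_of_ge (hw.mem_charZeroSet hA) hle)
    exact ⟨hw.isBoxEigenvalue hA, hw.tendsto_perronEigenvalue hA⟩
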